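/- Let $X$ be a completely regular (Hausdorff) topological space and let $\mathcal M_r(X)$ be the real vector space of signed Radon measures on $X$, that is, of the finite signed Borel measures $\mu$ such that for every Borel set $B$ and every $\varepsilon>0$ there is a compact set $K\subset B$ with $|\mu|(B\setminus K)<\varepsilon$. The weak topology on $\mathcal M_r(X)$ is generated by the seminorms $\mu\mapsto\left|\int_X f\,d\mu\right|$, where $f$ runs over the bounded continuous real functions on $X$. For a continuous pseudometric $p$ on $X$ put $$\|\mu\|_{KR,p}=\sup\Bigl\{\int_X f\,d\mu:\ |f|\le 1,\ |f(x)-f(y)|\le p(x,y)\ \text{for all } x,y\in X\Bigr\}.$$ For a family $\Pi$ of continuous pseudometrics let $\tau_{KR}(\Pi)$ be the topology on $\mathcal M_r(X)$ generated by the seminorms $\|\cdot\|_{KR,p}$, $p\in\Pi$, and let $\tau_{KR}$ be the topology obtained when $\Pi$ consists of all continuous pseudometrics on $X$. Suppose that $X$ is separable or that there is a countable collection of continuous real functions on $X$ separating the points of $X$. Then for every weakly compact set $S\subset\mathcal M_r(X)$ the weak topology and $\tau_{KR}$ induce the same topology on $S$. More generally, the weak topology and $\tau_{KR}(\Pi)$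 induce the same topology on $S$ for every nonempty family $\Pi$ of pseudometrics whose open balls generate the topology of $X$ and which is directed, i.e., for all $p,q\in\Pi$ there are $r\in\Pi$ and a constant $C$ with $\max(p,q)\le C\,r$ (for instance, $\Pi$ is closed under maxima). -/

import Mathlib

open MeasureTheory Topology
open scoped BoundedContinuousFunction ENNReal

namespace KantorovichRubinstein

noncomputable section

/-- The topology generated by a set of seminorms: the coarsest one that is finer than the topology
of each of the semimetrics `(x, y) ↦ q (x - y)`. -/
@[reducible]
def seminormTopology {E : Type*} [AddCommGroup E] [Module ℝ E] (Q : Set (Seminorm ℝ E)) :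
    TopologicalSpace E :=
  ⨅ q ∈ Q, q.toSeminormedAddCommGroup.toUniformSpace.toTopologicalSpace

section Pseudometrics

variable (X : Type*) [t : TopologicalSpace X]

/-- All continuous pseudometrics on `X`. -/
def continuousPseudometrics : Set (PseudoMetric X ℝ) :=
  {p | Continuous fun z : X × X => p z.1 z.2}

variable {X}

/-- The topology of `X` is generated by the (open) balls of the pseudometrics in `P`. -/
def GeneratesTopology (P : Set (PseudoMetric X ℝ)) : Prop :=
  t = TopologicalSpace.generateFrom
    {U | ∃ p ∈ P, ∃ x : X, ∃ r : ℝ, 0 < r ∧ U = {y | p x y < r}}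

/-- `P` is nonempty and any two members are dominated by a constant multiple of a third one
(for instance, `P` is closed under maxima). -/
def IsDirectedFamily (P : Set (PseudoMetric X ℝ)) : Prop :=
  P.Nonempty ∧ ∀ p ∈ P, ∀ q ∈ P, ∃ r ∈ P, ∃ C : ℝ, ∀ x y, p x y ≤ C * r x y ∧ q x y ≤ C * r x y

/-- The functions `f` with `|f| ≤ 1` that are `1`-Lipschitz for `p`. (If `p` is continuous, then
the continuity of `f` follows from the Lipschitz condition.) -/
def lipUnitBall (p : PseudoMetric X ℝ) : Set (X →ᵇ ℝ) :=
  {f | (∀ x, |f x| ≤ 1) ∧ ∀ x y, |f x - f y| ≤ p x y}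

theorem neg_mem_lipUnitBall {p : PseudoMetric X ℝ} {f : X →ᵇ ℝ} (hf : f ∈ lipUnitBall p) :
    -f ∈ lipUnitBall p := by
  refine ⟨fun x => by simpa using hf.1 x, fun x y => ?_⟩
  have := hf.2 y x
  rw [p.symm x y]
  simpa [neg_add_eq_sub] using this

theorem zero_mem_lipUnitBall (p : PseudoMetric X ℝ) : (0 : X →ᵇ ℝ) ∈ lipUnitBall p :=
  ⟨fun x => by simp, fun x y => by simpa using p.nonneg x y⟩

end Pseudometrics

section Measures

variable {X : Type*} [TopologicalSpace X] [MeasurableSpace X]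

/-- A signed measure is Radon if its total variation is inner regular with respect to compact sets
on all Borel sets. -/
def IsRadon (μ : SignedMeasure X) : Prop :=
  ∀ B : Set X, MeasurableSet B → ∀ ε : ℝ≥0∞, 0 < ε →
    ∃ K : Set X, IsCompact K ∧ K ⊆ B ∧ μ.totalVariation (B \ K) < ε

theorem IsRadon.add {μ ν : SignedMeasure X} (hμ : IsRadon μ) (hν : IsRadon ν) :
    IsRadon (μ + ν) := by
  intro B hB ε hε
  have h2 : 0 < ε / 2 := ENNReal.half_pos hε.ne'
  obtain ⟨K, hK, hKB, hKε⟩ := hμ B hB _ h2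
  obtain ⟨L, hL, hLB, hLε⟩ := hν B hB _ h2
  refine ⟨K ∪ L, hK.union hL, Set.union_subset hKB hLB, ?_⟩
  have h : (μ + ν).totalVariation ≤ μ.totalVariation + ν.totalVariation := by
    simp only [SignedMeasure.totalVariation_eq_variation]
    exact VectorMeasure.variation_add_le
  calc (μ + ν).totalVariation (B \ (K ∪ L))
      ≤ μ.totalVariation (B \ (K ∪ L)) + ν.totalVariation (B \ (K ∪ L)) := h _
    _ ≤ μ.totalVariation (B \ K) + ν.totalVariation (B \ L) := by
        gcongr
        · exact Set.subset_union_left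
        · exact Set.subset_union_right
    _ < ε / 2 + ε / 2 := ENNReal.add_lt_add hKε hLε
    _ = ε := ENNReal.add_halves ε

theorem IsRadon.zero : IsRadon (0 : SignedMeasure X) := fun B _ ε hε =>
  ⟨∅, isCompact_empty, Set.empty_subset B, by simpa [SignedMeasure.totalVariation_zero] using hε⟩

theorem IsRadon.smul (c : ℝ) {μ : SignedMeasure X} (hμ : IsRadon μ) : IsRadon (c • μ) := by
  intro B hB ε hε
  obtain ⟨K, hK, hKB, hKε⟩ := hμ B hB (ε / (‖c‖₊ + 1))
    (ENNReal.div_pos hε.ne' (by finiteness))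
  refine ⟨K, hK, hKB, ?_⟩
  have h : (c • μ).totalVariation (B \ K) = ‖c‖₊ * μ.totalVariation (B \ K) := by
    simp only [SignedMeasure.totalVariation_eq_variation, VectorMeasure.variation_smul]
    rfl
  rw [h]
  calc (‖c‖₊ : ℝ≥0∞) * μ.totalVariation (B \ K)
      ≤ (‖c‖₊ + 1) * μ.totalVariation (B \ K) := by gcongr; exact le_self_add
    _ < ε := by
        rw [mul_comm]
        exact (ENNReal.lt_div_iff_mul_lt (by simp) (by simp)).1 hKε

variable (X) in
/-- The real vector space of signed Radon measures on `X`. -/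
def radonMeasures : Submodule ℝ (SignedMeasure X) where
  carrier := {μ | IsRadon μ}
  add_mem' := IsRadon.add
  zero_mem' := IsRadon.zero
  smul_mem' c _ := IsRadon.smul c

instance isFiniteMeasure_variation (μ : SignedMeasure X) : IsFiniteMeasure μ.variation := by
  rw [← SignedMeasure.totalVariation_eq_variation]
  infer_instance

variable [OpensMeasurableSpace X]

theorem integrable_bcf (f : X →ᵇ ℝ) (μ : SignedMeasure X) : μ.Integrable f :=
  f.integrable μ.variation

/-- The functional `μ ↦ ∫ f dμ` on signed Radon measures, for a bounded continuous `f`. -/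
def integralFunctional (f : X →ᵇ ℝ) : radonMeasures X →ₗ[ℝ] ℝ where
  toFun μ := (μ : SignedMeasure X).integral f (ContinuousLinearMap.lsmul ℝ ℝ)
  map_add' μ ν := VectorMeasure.integral_add_vectorMeasure
    (integrable_bcf f μ) (integrable_bcf f ν)
  map_smul' c _ := VectorMeasure.integral_smul_vectorMeasure (⇑f) c

variable (X) in
/-- The weak topology on signed Radon measures, generated by the seminorms `μ ↦ |∫ f dμ|` with
`f` bounded and continuous. -/
@[reducible]
def weakTopology : TopologicalSpace (radonMeasures X) :=
  seminormTopology
    (Set.range fun f : X →ᵇ ℝ => (normSeminorm ℝ ℝ).comp (integralFunctional f))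

/-- `‖μ‖_{KR,p}`, the supremum of `∫ f dμ` over the `1`-Lipschitz functions with `|f| ≤ 1`. -/
def krNorm (p : PseudoMetric X ℝ) (μ : radonMeasures X) : ℝ :=
  sSup ((fun f => integralFunctional f μ) '' lipUnitBall p)

theorem bddAbove_krNorm (p : PseudoMetric X ℝ) (μ : radonMeasures X) :
    BddAbove ((fun f => integralFunctional f μ) '' lipUnitBall p) := by
  refine ⟨1 * ‖ContinuousLinearMap.lsmul ℝ ℝ (E := ℝ)‖ *
    (μ : SignedMeasure X).variation.real Set.univ, ?_⟩
  rintro _ ⟨f, hf, rfl⟩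
  have h := VectorMeasure.norm_integral_le_of_norm_le_const (μ := (μ : SignedMeasure X))
    (B := ContinuousLinearMap.lsmul ℝ ℝ) (f := ⇑f) (C := 1) (Filter.Eventually.of_forall hf.1)
  exact (le_abs_self _).trans h

theorem integralFunctional_neg (f : X →ᵇ ℝ) (μ : radonMeasures X) :
    integralFunctional (-f) μ = -integralFunctional f μ :=
  VectorMeasure.integral_neg (⇑f) (μ : SignedMeasure X) (ContinuousLinearMap.lsmul ℝ ℝ)

theorem le_krNorm {p : PseudoMetric X ℝ} {f : X →ᵇ ℝ} (hf : f ∈ lipUnitBall p)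
    (μ : radonMeasures X) : |integralFunctional f μ| ≤ krNorm p μ := by
  refine abs_le'.2 ⟨le_csSup (bddAbove_krNorm p μ) ⟨f, hf, rfl⟩, ?_⟩
  rw [← integralFunctional_neg]
  exact le_csSup (bddAbove_krNorm p μ) ⟨-f, neg_mem_lipUnitBall hf, rfl⟩

theorem krNorm_le {p : PseudoMetric X ℝ} {μ : radonMeasures X} {a : ℝ}
    (h : ∀ f ∈ lipUnitBall p, integralFunctional f μ ≤ a) : krNorm p μ ≤ a := by
  refine csSup_le ⟨_, 0, zero_mem_lipUnitBall p, rfl⟩ ?_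
  rintro _ ⟨f, hf, rfl⟩
  exact h f hf

/-- The Kantorovich–Rubinstein seminorm `‖·‖_{KR,p}` on signed Radon measures. -/
def krSeminorm (p : PseudoMetric X ℝ) : Seminorm ℝ (radonMeasures X) :=
  Seminorm.ofSMulLE (krNorm p)
    (le_antisymm (krNorm_le fun f _ => by simp)
      ((abs_nonneg _).trans (le_krNorm (zero_mem_lipUnitBall p) 0)))
    (fun μ ν => krNorm_le fun f hf => by
      rw [map_add]
      exact add_le_add ((le_abs_self _).trans (le_krNorm hf μ))
        ((le_abs_self _).trans (le_krNorm hf ν)))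
    (fun c μ => krNorm_le fun f hf => by
      rw [map_smul, smul_eq_mul, Real.norm_eq_abs]
      refine (le_abs_self _).trans ?_
      rw [abs_mul]
      exact mul_le_mul_of_nonneg_left (le_krNorm hf μ) (abs_nonneg c))

/-- The Kantorovich–Rubinstein topology generated by the seminorms `‖·‖_{KR,p}`, `p ∈ P`. -/
@[reducible]
def krTopology (P : Set (PseudoMetric X ℝ)) : TopologicalSpace (radonMeasures X) :=
  seminormTopology (krSeminorm '' P)

end Measures

/-- Two topologies on `E` induce the same topology on the subset `S`. -/
def CoincideOn {E : Type*} (t₁ t₂ : TopologicalSpace E) (S : Set E) : Prop :=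
  TopologicalSpace.induced ((↑) : S → E) t₁ = TopologicalSpace.induced ((↑) : S → E) t₂

end

end KantorovichRubinstein

/-!
The Kantorovich–Rubinstein topology is Hausdorff, so on a weakly compact set `S` it suffices that
the identity be continuous into it. As the `p`-Lipschitz unit ball is compact for pointwise
convergence, this reduces to `∫ uᵢ dνᵢ → 0` for `νᵢ ∈ S` and `p`-Lipschitz `uᵢ` tending to `0`
pointwise along a filter. Suppose this fails. Each `νᵢ` is almost carried by a compact set, near
which all later `uⱼ` are uniformly small, so one can extract `νₙ ∈ S` and `p`-Lipschitz humps `hₙ`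
with pairwise disjoint supports and `|∫ hₙ dνₙ|` bounded below. All the sums `∑ n ∈ A, hₙ` are
bounded and continuous, and a Baire category argument over `A ⊆ ℕ`, as in the lemma of Phillips,
gives `∫ hₙ dνₙ → 0`, a contradiction.
-/

namespace KantorovichRubinstein

noncomputable section

open Filter Set

section SeminormTopology

theorem induced_domRestrict_eq_of_isCompact {X Y : Type*} [TopologicalSpace X] [TopologicalSpace Y]
    [T2Space Y] {f : X → Y} {S : Set X} (hS : IsCompact S) (hf : ContinuousOn f S)
    (hinj : InjOn f S) :
    (inferInstance : TopologicalSpace S) = .induced (S.domRestrict f) inferInstance := by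
  have : CompactSpace S := isCompact_iff_compactSpace.1 hS
  have hc : Continuous (S.domRestrict f) := continuousOn_iff_continuous_domRestrict.1 hf
  exact (hc.isClosedEmbedding (injOn_iff_injective.1 hinj)).isInducing.eq_induced

variable {E : Type*}

theorem coincideOn_of_continuousOn_id {t₁ t₂ : TopologicalSpace E} {S : Set E}
    (hS : @IsCompact E t₁ S) (h₂ : @T2Space E t₂) (h : @ContinuousOn E E t₁ t₂ id S) :
    CoincideOn t₁ t₂ S :=
  @induced_domRestrict_eq_of_isCompact E E t₁ t₂ h₂ id S hS h (injOn_id S)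

variable [AddCommGroup E] [Module ℝ E] {Q : Set (Seminorm ℝ E)}

theorem tendsto_seminormTopology_iff {ι : Type*} {l : Filter ι} {u : ι → E} {a : E} :
    Tendsto u l (@nhds E (seminormTopology Q) a) ↔
      ∀ q ∈ Q, Tendsto (fun i => q (u i - a)) l (𝓝 0) := by
  simp only [nhds_iInf, tendsto_iInf]
  refine forall₂_congr fun q _ => ?_
  let := q.toSeminormedAddCommGroup
  exact tendsto_iff_norm_sub_tendsto_zero

theorem t2Space_seminormTopology (hQ : ∀ x : E, (∀ q ∈ Q, q x = 0) → x = 0) :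
    @T2Space E (seminormTopology Q) := by
  let := seminormTopology Q
  refine t2_iff_ultrafilter.2 fun {x y} F hx hy => sub_eq_zero.1 (hQ _ fun q hq => ?_)
  have hqx := tendsto_seminormTopology_iff.1 (tendsto_id'.2 hx) q hq
  have hqy := tendsto_seminormTopology_iff.1 (tendsto_id'.2 hy) q hq
  refine le_antisymm (ge_of_tendsto' (by simpa using hqy.add hqx) fun z => ?_) (apply_nonneg q _)
  simpa using map_sub_le_add q (z - y) (z - x)

end SeminormTopology

section Integral

variable {X : Type*} [MeasurableSpace X]

theorem abs_integral_le_mul_variation (μ : SignedMeasure X) {f : X → ℝ} {A : Set X} {C : ℝ}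
    (hC : 0 ≤ C) (hf : ∀ x ∈ A, |f x| ≤ C) (hf' : ∀ x ∉ A, f x = 0) :
    |∫ᵛ x, f x ∂•μ| ≤ C * μ.variation.real A := by
  have hle : ∫⁻ x, ENNReal.ofReal ‖f x‖ ∂μ.variation ≤ ENNReal.ofReal C * μ.variation A := by
    refine (lintegral_mono fun x => ?_).trans (lintegral_indicator_const_le A _)
    by_cases hx : x ∈ A
    · simpa [hx] using ENNReal.ofReal_le_ofReal (hf x hx)
    · simp [hx, hf' x hx]
  rw [← Real.norm_eq_abs]
  calc ‖∫ᵛ x, f x ∂•μ‖ ≤ ‖ContinuousLinearMap.lsmul ℝ ℝ (E := ℝ)‖ *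
        (∫⁻ x, ENNReal.ofReal ‖f x‖ ∂μ.variation).toReal :=
        VectorMeasure.norm_integral_le_lintegral_norm
    _ ≤ 1 * (ENNReal.ofReal C * μ.variation A).toReal := by
        gcongr
        · exact ContinuousLinearMap.opNorm_lsmul_le
        · finiteness
    _ = C * μ.variation.real A := by
        rw [one_mul, ENNReal.toReal_mul, ENNReal.toReal_ofReal hC, measureReal_def]

variable [TopologicalSpace X]

theorem exists_isCompact_variation_lt (μ : radonMeasures X) {B : Set X} (hB : MeasurableSet B)
    {ε : ℝ} (hε : 0 < ε) :
    ∃ K ⊆ B, IsCompact K ∧ (μ : SignedMeasure X).variation.real (B \ K) < ε := by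
  obtain ⟨K, hK, hKB, h⟩ := μ.2 B hB (ENNReal.ofReal ε) (ENNReal.ofReal_pos.2 hε)
  rw [SignedMeasure.totalVariation_eq_variation] at h
  exact ⟨K, hKB, hK, (ENNReal.lt_ofReal_iff_toReal_lt (measure_ne_top _ _)).1 h⟩

variable [OpensMeasurableSpace X]

/-- The pairing `∫ f dμ` of Radon measures with bounded continuous functions, as a linear map into
the dual of the latter. -/
def integralCLM : radonMeasures X →ₗ[ℝ] (X →ᵇ ℝ) →L[ℝ] ℝ where
  toFun μ := LinearMap.mkContinuous
    { toFun := fun f => integralFunctional f μ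
      map_add' := fun f g => VectorMeasure.integral_add (integrable_bcf f μ) (integrable_bcf g μ)
      map_smul' := fun c f => VectorMeasure.integral_smul (⇑f) (μ : SignedMeasure X) _ c }
    ((μ : SignedMeasure X).variation.real univ) fun f => by
      rw [mul_comm]
      exact abs_integral_le_mul_variation _ (norm_nonneg f) (fun x _ => f.norm_coe_le_norm x)
        fun x hx => (hx (mem_univ x)).elim
  map_add' μ ν := ContinuousLinearMap.ext fun f => map_add (integralFunctional f) μ ν
  map_smul' c μ := ContinuousLinearMap.ext fun f => map_smul (integralFunctional f) c μ

theorem integralCLM_apply (μ : radonMeasures X) (f : X →ᵇ ℝ) :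
    integralCLM μ f = integralFunctional f μ := rfl

theorem integralCLM_sub_apply (μ ν : radonMeasures X) (f : X →ᵇ ℝ) :
    integralCLM (μ - ν) f = integralCLM μ f - integralCLM ν f :=
  map_sub (integralFunctional f) μ ν

theorem abs_integralCLM_le_mul_variation (μ : radonMeasures X) {f : X →ᵇ ℝ} {A : Set X} {C : ℝ}
    (hC : 0 ≤ C) (hf : ∀ x ∈ A, |f x| ≤ C) (hf' : ∀ x ∉ A, f x = 0) :
    |integralCLM μ f| ≤ C * (μ : SignedMeasure X).variation.real A :=
  abs_integral_le_mul_variation _ hC hf hf'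

theorem tendsto_weakTopology_iff {ι : Type*} {l : Filter ι} {u : ι → radonMeasures X}
    {μ : radonMeasures X} :
    Tendsto u l (@nhds _ (weakTopology X) μ) ↔
      ∀ f, Tendsto (fun i => integralCLM (u i) f) l (𝓝 (integralCLM μ f)) := by
  simp only [tendsto_seminormTopology_iff, forall_mem_range, integralCLM_apply,
    tendsto_iff_norm_sub_tendsto_zero (b := integralFunctional _ μ), Seminorm.comp_apply,
    coe_normSeminorm, map_sub]

theorem continuous_integralCLM_apply (f : X →ᵇ ℝ) :
    @Continuous _ _ (weakTopology X) _ fun μ => integralCLM μ f :=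
  let := weakTopology X
  continuous_iff_continuousAt.2 fun _ => tendsto_weakTopology_iff.1 tendsto_id f

theorem exists_forall_norm_integralCLM_le {S : Set (radonMeasures X)}
    (hS : @IsCompact _ (weakTopology X) S) : ∃ M, ∀ μ ∈ S, ‖integralCLM μ‖ ≤ M := by
  let := weakTopology X
  obtain ⟨M, hM⟩ := banach_steinhaus (g := fun μ : S => integralCLM (μ : radonMeasures X))
    fun f => by
      obtain ⟨C, hC⟩ :=
        hS.exists_bound_of_continuousOn (continuous_integralCLM_apply f).continuousOn
      exact ⟨C, fun μ => hC μ μ.2⟩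
  exact ⟨M, fun μ hμ => hM ⟨μ, hμ⟩⟩

end Integral

section Tent

variable {X : Type*} {p : PseudoMetric X ℝ} {K : Set X} {r : ℝ}

/-- The open `r`-neighbourhood of `K` for the pseudometric `p`; the analogue of
`Metric.thickening`. -/
def thickening (p : PseudoMetric X ℝ) (r : ℝ) (K : Set X) : Set X :=
  {x | ∃ y ∈ K, p x y < r}

/-- The function `max (0, r - p(x, K))`, written as a supremum so that it is `0` for empty `K`. -/
def tent (p : PseudoMetric X ℝ) (r : ℝ) (K : Set X) (x : X) : ℝ :=
  ⨆ y : K, max 0 (r - p x y)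

theorem tent_nonneg (x : X) : 0 ≤ tent p r K x :=
  Real.iSup_nonneg fun _ => le_max_left _ _

theorem max_zero_sub_le (hr : 0 ≤ r) (x y : X) : max 0 (r - p x y) ≤ r :=
  max_le hr (sub_le_self _ (p.nonneg x y))

theorem tent_le (hr : 0 ≤ r) (x : X) : tent p r K x ≤ r :=
  Real.iSup_le (fun y => max_zero_sub_le hr x y) hr

theorem abs_tent_le (hr : 0 ≤ r) (x : X) : |tent p r K x| ≤ r :=
  (abs_of_nonneg (tent_nonneg x)).trans_le (tent_le hr x)

theorem max_zero_sub_le_tent (hr : 0 ≤ r) (x : X) {y : X} (hy : y ∈ K) :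
    max 0 (r - p x y) ≤ tent p r K x :=
  le_ciSup (f := fun y : K => max 0 (r - p x y))
    ⟨r, forall_mem_range.2 fun y => max_zero_sub_le hr x y⟩ ⟨y, hy⟩

theorem tent_eq_of_mem (hr : 0 ≤ r) {x : X} (hx : x ∈ K) : tent p r K x = r :=
  (tent_le hr x).antisymm (by simpa [p.refl, hr] using max_zero_sub_le_tent (p := p) hr x hx)

theorem support_tent_subset : Function.support (tent p r K) ⊆ thickening p r K := by
  intro x hx
  by_contra h
  refine hx ((Real.iSup_le (fun y => max_le le_rfl ?_) le_rfl).antisymm (tent_nonneg x))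
  exact sub_nonpos.2 (not_lt.1 fun hxy => h ⟨y, y.2, hxy⟩)

theorem tent_sub_le (hr : 0 ≤ r) (x y : X) : tent p r K x - tent p r K y ≤ p x y := by
  rw [sub_le_iff_le_add]
  refine Real.iSup_le (fun z => ?_) (add_nonneg (p.nonneg x y) (tent_nonneg y))
  have hz := max_zero_sub_le_tent (p := p) hr y z.2
  have htri := p.triangle y x z
  rw [p.symm y x] at htri
  refine max_le ?_ ?_
  · linarith [p.nonneg x y, tent_nonneg (p := p) (r := r) (K := K) y]
  · linarith [le_max_right 0 (r - p y z)]

theorem abs_tent_sub_le (hr : 0 ≤ r) (x y : X) : |tent p r K x - tent p r K y| ≤ p x y :=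
  abs_sub_le_iff.2 ⟨tent_sub_le hr x y, p.symm x y ▸ tent_sub_le hr y x⟩

end Tent

section ContinuousPseudometric

variable {X : Type*} [TopologicalSpace X] {p q : PseudoMetric X ℝ}

theorem mem_continuousPseudometrics_iff :
    p ∈ continuousPseudometrics X ↔ ∀ x, Tendsto (p x) (𝓝 x) (𝓝 0) := by
  refine ⟨fun hp x => ?_, fun h => continuous_iff_continuousAt.2 fun ⟨x, y⟩ => ?_⟩
  · have : Continuous fun y => p x y := hp.comp (Continuous.prodMk_right x)
    simpa [p.refl] using this.tendsto x
  · have hsum : Tendsto (fun z : X × X => p x z.1 + p y z.2) (𝓝 (x, y)) (𝓝 0) := by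
      simpa using ((h x).comp (continuous_fst.tendsto (x, y))).add
        ((h y).comp (continuous_snd.tendsto (x, y)))
    refine tendsto_iff_dist_tendsto_zero.2 (squeeze_zero (fun _ => dist_nonneg) (fun z => ?_) hsum)
    have h₁ := p.triangle z.1 x z.2
    have h₂ := p.triangle x y z.2
    have h₃ := p.triangle x z.1 y
    have h₄ := p.triangle z.1 z.2 y
    simp only [p.symm z.1 x, p.symm z.2 y] at h₁ h₃ h₄
    exact abs_sub_le_iff.2 ⟨by dsimp only; linarith, by dsimp only; linarith⟩

theorem eventually_lt_of_mem_continuousPseudometrics (hp : p ∈ continuousPseudometrics X) (x : X)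
    {r : ℝ} (hr : 0 < r) : ∀ᶠ y in 𝓝 x, p x y < r :=
  (mem_continuousPseudometrics_iff.1 hp x).eventually_lt_const hr

theorem sup_mem_continuousPseudometrics (hp : p ∈ continuousPseudometrics X)
    (hq : q ∈ continuousPseudometrics X) : p ⊔ q ∈ continuousPseudometrics X :=
  Continuous.max hp hq

theorem continuous_of_abs_sub_le (hp : p ∈ continuousPseudometrics X) {f : X → ℝ} {C : ℝ}
    (hf : ∀ x y, |f x - f y| ≤ C * p x y) : Continuous f := by
  refine continuous_iff_continuousAt.2 fun x => tendsto_iff_dist_tendsto_zero.2 ?_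
  refine squeeze_zero (fun _ => dist_nonneg) (fun y => ?_)
    (by simpa using (mem_continuousPseudometrics_iff.1 hp x).const_mul C)
  rw [dist_comm]
  exact hf x y

theorem exists_mem_lipUnitBall_coe_eq (hp : p ∈ continuousPseudometrics X) {f : X → ℝ}
    (hf : ∀ x, |f x| ≤ 1) (hfp : ∀ x y, |f x - f y| ≤ p x y) : ∃ g ∈ lipUnitBall p, ⇑g = f :=
  ⟨.ofNormedAddCommGroup f (continuous_of_abs_sub_le (C := 1) hp (by simpa using hfp)) 1 hf,
    ⟨hf, hfp⟩, rfl⟩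

theorem exists_mem_lipUnitBall_coe_eq_tent (hp : p ∈ continuousPseudometrics X) {r : ℝ}
    (hr : 0 ≤ r) (hr₁ : r ≤ 1) (K : Set X) : ∃ g ∈ lipUnitBall p, ⇑g = tent p r K :=
  exists_mem_lipUnitBall_coe_eq hp (fun x => (abs_tent_le hr x).trans hr₁) (abs_tent_sub_le hr)

theorem half_sub_mem_lipUnitBall {f g : X →ᵇ ℝ} (hf : f ∈ lipUnitBall p) (hg : g ∈ lipUnitBall p) :
    (2⁻¹ : ℝ) • (f - g) ∈ lipUnitBall p := by
  refine ⟨fun x => ?_, fun x y => ?_⟩ <;>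
    simp only [BoundedContinuousFunction.coe_smul, BoundedContinuousFunction.sub_apply, smul_eq_mul]
  · grind [hf.1 x, hg.1 x]
  · grind [hf.2 x y, hg.2 x y]

theorem exists_tendsto_of_lipUnitBall (hp : p ∈ continuousPseudometrics X) {ι : Type*}
    (F : Ultrafilter ι) {f : ι → X →ᵇ ℝ} (hf : ∀ i, f i ∈ lipUnitBall p) :
    ∃ g ∈ lipUnitBall p, ∀ x, Tendsto (fun i => f i x) F (𝓝 (g x)) := by
  have hlim (x : X) : ∃ a, Tendsto (fun i => f i x) F (𝓝 a) := by
    obtain ⟨a, -, ha⟩ := (isCompact_Icc (a := (-1 : ℝ)) (b := 1)).ultrafilter_le_nhds'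
      (F.map fun i => f i x)
      (Ultrafilter.mem_map.2 (univ_mem' fun i => abs_le.1 ((hf i).1 x)))
    exact ⟨a, ha⟩
  choose g hg using hlim
  have hb (x : X) : |g x| ≤ 1 := le_of_tendsto' (hg x).abs fun i => (hf i).1 x
  have hL (x y : X) : |g x - g y| ≤ p x y :=
    le_of_tendsto' ((hg x).sub (hg y)).abs fun i => (hf i).2 x y
  obtain ⟨g', hg', rfl⟩ := exists_mem_lipUnitBall_coe_eq hp hb hL
  exact ⟨g', hg', hg⟩

theorem eventually_forall_thickening_abs_lt (hp : p ∈ continuousPseudometrics X) {ι : Type*}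
    {l : Filter ι} {u : ι → X → ℝ} (hu : ∀ i x y, |u i x - u i y| ≤ p x y)
    (hlim : ∀ x, Tendsto (fun i => u i x) l (𝓝 0)) {K : Set X} (hK : IsCompact K) {r : ℝ}
    (hr : 0 < r) : ∀ᶠ i in l, ∀ x ∈ thickening p r K, |u i x| < 2 * r := by
  have hK' : ∀ᶠ z in l ×ˢ 𝓝ˢ K, |u z.1 z.2| < r :=
    hK.mem_prod_nhdsSet_of_forall fun x _ => by
      have hux := (hlim x).abs.eventually_lt_const (abs_zero.trans_lt (half_pos hr))
      filter_upwards [hux.prod_mk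
        (eventually_lt_of_mem_continuousPseudometrics hp x (half_pos hr))] with z hz
      grind [hu z.1 x z.2]
  filter_upwards [hK'.curry] with i hi x ⟨y, hy, hxy⟩
  grind [hu i x y, hi.self_of_nhdsSet y hy]

end ContinuousPseudometric

section GeneratesTopology

variable {X : Type*} {P : Set (PseudoMetric X ℝ)}

theorem IsDirectedFamily.exists_lt_imp (hd : IsDirectedFamily P) {p q : PseudoMetric X ℝ}
    (hp : p ∈ P) (hq : q ∈ P) {r s : ℝ} (hr : 0 < r) (hs : 0 < s) :
    ∃ p' ∈ P, ∃ δ > 0, ∀ x y, p' x y < δ → p x y < r ∧ q x y < s := by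
  obtain ⟨p', hp', C, hC⟩ := hd.2 p hp q hq
  have hC' : 0 < |C| + 1 := by positivity
  refine ⟨p', hp', min r s / (|C| + 1), by positivity, fun x y hxy => ?_⟩
  have hmin : C * p' x y < min r s :=
    calc C * p' x y ≤ p' x y * (|C| + 1) := by nlinarith [p'.nonneg x y, le_abs_self C]
      _ < min r s := (lt_div_iff₀ hC').1 hxy
  exact ⟨(hC x y).1.trans_lt (hmin.trans_le (min_le_left _ _)),
    (hC x y).2.trans_lt (hmin.trans_le (min_le_right _ _))⟩

variable [TopologicalSpace X]

variable (X) in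
theorem isDirectedFamily_continuousPseudometrics : IsDirectedFamily (continuousPseudometrics X) :=
  ⟨⟨⊥, continuous_const⟩, fun p hp q hq =>
    ⟨p ⊔ q, sup_mem_continuousPseudometrics hp hq, 1, fun x y => by simp⟩⟩

/-- The pseudometric `|f x - f y|` defined by a real function `f`. -/
def absSubPseudoMetric (f : X → ℝ) : PseudoMetric X ℝ where
  toFun x y := |f x - f y|
  refl' x := by simp
  symm' x y := abs_sub_comm _ _
  triangle' x y z := abs_sub_le _ _ _

theorem isOpen_setOf_lt_of_mem_continuousPseudometrics {p : PseudoMetric X ℝ}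
    (hp : p ∈ continuousPseudometrics X) (x : X) (r : ℝ) : IsOpen {y | p x y < r} :=
  isOpen_lt (hp.comp (Continuous.prodMk_right x)) continuous_const

variable (X) in
theorem generatesTopology_continuousPseudometrics [CompletelyRegularSpace X] :
    GeneratesTopology (continuousPseudometrics X) := by
  refine le_antisymm (le_generateFrom ?_) fun U hU => ?_
  · rintro _ ⟨p, hp, x, r, -, rfl⟩
    exact isOpen_setOf_lt_of_mem_continuousPseudometrics hp x r
  refine (@isOpen_iff_forall_mem_open X (.generateFrom _) U).2 fun x hx => ?_
  obtain ⟨f, hf, hfx, hfU⟩ := CompletelyRegularSpace.completely_regular x Uᶜ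
    (isClosed_compl_iff.2 hU) (notMem_compl_iff.2 hx)
  have hp : absSubPseudoMetric (fun y => (f y : ℝ)) ∈ continuousPseudometrics X := by
    change Continuous fun z : X × X => |(f z.1 : ℝ) - f z.2|
    fun_prop
  refine ⟨{y | absSubPseudoMetric (fun y => (f y : ℝ)) x y < 1}, fun y hy => ?_,
    .basic _ ⟨_, hp, x, 1, one_pos, rfl⟩, ?_⟩
  · by_contra hyU
    have hfy : f y = 1 := hfU hyU
    have hlt : |(f x : ℝ) - f y| < 1 := hy
    simp [hfx, hfy] at hlt
  · simp [PseudoMetric.refl]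

theorem GeneratesTopology.subset_continuousPseudometrics (hP : GeneratesTopology P) :
    P ⊆ continuousPseudometrics X := fun p hp =>
  mem_continuousPseudometrics_iff.2 fun x => tendsto_order.2
    ⟨fun a ha => .of_forall fun y => ha.trans_le (p.nonneg x y), fun r hr => by
      refine IsOpen.mem_nhds (s := {y | p x y < r}) ?_ ((p.refl x).trans_lt hr)
      rw [GeneratesTopology] at hP
      rw [hP]
      exact .basic _ ⟨p, hp, x, r, hr, rfl⟩⟩

theorem GeneratesTopology.exists_ball_subset (hP : GeneratesTopology P) (hd : IsDirectedFamily P)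
    {U : Set X} (hU : IsOpen U) {x : X} (hx : x ∈ U) :
    ∃ p ∈ P, ∃ r > 0, {y | p x y < r} ⊆ U := by
  rw [GeneratesTopology] at hP
  rw [hP] at hU
  induction hU with
  | basic s hs =>
    obtain ⟨p, hp, z, r, -, rfl⟩ := hs
    refine ⟨p, hp, r - p z x, sub_pos.2 hx, fun y hy => ?_⟩
    exact (p.triangle z x y).trans_lt (lt_sub_iff_add_lt'.1 hy)
  | univ =>
    obtain ⟨p, hp⟩ := hd.1
    exact ⟨p, hp, 1, one_pos, subset_univ _⟩
  | inter s s' _ _ ih ih' =>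
    obtain ⟨p, hp, r, hr, h⟩ := ih hx.1
    obtain ⟨q, hq, r', hr', h'⟩ := ih' hx.2
    obtain ⟨p', hp', δ, hδ, H⟩ := hd.exists_lt_imp hp hq hr hr'
    exact ⟨p', hp', δ, hδ, fun y hy => ⟨h (H x y hy).1, h' (H x y hy).2⟩⟩
  | sUnion T _ ih =>
    obtain ⟨s, hs, hxs⟩ := hx
    obtain ⟨p, hp, r, hr, h⟩ := ih s hs hxs
    exact ⟨p, hp, r, hr, h.trans (subset_sUnion_of_mem hs)⟩

theorem GeneratesTopology.regularSpace (hP : GeneratesTopology P) (hd : IsDirectedFamily P) :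
    RegularSpace X := by
  refine .of_exists_mem_nhds_isClosed_subset fun x s hs => ?_
  obtain ⟨U, hUs, hU, hxU⟩ := mem_nhds_iff.1 hs
  obtain ⟨p, hp, r, hr, hrU⟩ := hP.exists_ball_subset hd hU hxU
  have hpc := hP.subset_continuousPseudometrics hp
  refine ⟨{y | p x y ≤ r / 2}, ?_, ?_, fun y hy => hUs (hrU (lt_of_le_of_lt hy (half_lt_self hr)))⟩
  · exact (eventually_lt_of_mem_continuousPseudometrics hpc x (half_pos hr)).mono fun _ => le_of_lt
  · exact isClosed_le (hpc.comp (Continuous.prodMk_right x)) continuous_const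

theorem GeneratesTopology.exists_thickening_subset (hP : GeneratesTopology P)
    (hd : IsDirectedFamily P) {K U : Set X} (hK : IsCompact K) (hU : IsOpen U) (hKU : K ⊆ U) :
    ∃ p ∈ P, ∃ r > 0, thickening p r K ⊆ U := by
  refine hK.induction_on (p := fun s => ∃ p ∈ P, ∃ r > 0, thickening p r s ⊆ U) ?_ ?_ ?_ ?_
  · obtain ⟨p, hp⟩ := hd.1
    exact ⟨p, hp, 1, one_pos, fun _ ⟨_, hy, _⟩ => hy.elim⟩
  · rintro s s' hs ⟨p, hp, r, hr, h⟩
    exact ⟨p, hp, r, hr, fun x ⟨y, hy, hxy⟩ => h ⟨y, hs hy, hxy⟩⟩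
  · rintro s s' ⟨p, hp, r, hr, h⟩ ⟨q, hq, r', hr', h'⟩
    obtain ⟨p', hp', δ, hδ, H⟩ := hd.exists_lt_imp hp hq hr hr'
    refine ⟨p', hp', δ, hδ, ?_⟩
    rintro x ⟨y, hy | hy, hxy⟩
    · exact h ⟨y, hy, (H x y hxy).1⟩
    · exact h' ⟨y, hy, (H x y hxy).2⟩
  · intro x hx
    obtain ⟨p, hp, r, hr, h⟩ := hP.exists_ball_subset hd hU (hKU hx)
    refine ⟨{y | p x y < r / 2}, mem_nhdsWithin_of_mem_nhds
      (eventually_lt_of_mem_continuousPseudometrics (hP.subset_continuousPseudometrics hp) x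
        (half_pos hr)), p, hp, r / 2, half_pos hr, ?_⟩
    rintro z ⟨y, hxy, hzy⟩
    refine h ((p.triangle x y z).trans_lt ?_)
    rw [p.symm y z]
    exact (add_lt_add hxy hzy).trans_eq (add_halves r)

end GeneratesTopology

section Separation

variable {X : Type*} [TopologicalSpace X] [MeasurableSpace X] [BorelSpace X]

theorem exists_isCompact_isClosed_variation_lt [R1Space X] (μ : radonMeasures X) {B : Set X}
    (hB : MeasurableSet B) {ε : ℝ} (hε : 0 < ε) :
    ∃ K ⊆ B, IsCompact K ∧ IsClosed K ∧ (μ : SignedMeasure X).variation.real (B \ K) < ε := by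
  obtain ⟨K, hKB, hK, h⟩ := exists_isCompact_variation_lt μ hB hε
  refine ⟨closure K, hK.closure_subset_measurableSet hB hKB, hK.closure, isClosed_closure, ?_⟩
  exact (measureReal_mono (sdiff_subset_sdiff_right subset_closure)).trans_lt h

theorem eq_zero_of_forall_isCompact_isClosed [R1Space X] {μ : radonMeasures X}
    (h : ∀ K, IsCompact K → IsClosed K → (μ : SignedMeasure X) K = 0) : μ = 0 := by
  refine Subtype.ext (VectorMeasure.ext fun B hB => ?_)
  refine eq_of_abs_sub_le_all fun ε hε => ?_
  obtain ⟨K, hKB, hK, hKc, hKε⟩ := exists_isCompact_isClosed_variation_lt μ hB hε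
  have hsdiff := VectorMeasure.of_add_of_sdiff hKc.measurableSet hB hKB (v := (μ : SignedMeasure X))
  rw [h K hK hKc, zero_add] at hsdiff
  simpa [← hsdiff] using
    (VectorMeasure.norm_measure_le_variation (μ := (μ : SignedMeasure X))).trans hKε.le

theorem integral_sub_indicator_const (μ : radonMeasures X) (f : X →ᵇ ℝ) {K : Set X}
    (hK : MeasurableSet K) (c : ℝ) :
    ∫ᵛ x, (f x - K.indicator (fun _ => c) x) ∂•(μ : SignedMeasure X) =
      integralCLM μ f - c * (μ : SignedMeasure X) K := by
  have hi : (μ : SignedMeasure X).Integrable (K.indicator fun _ => c) :=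
    (integrable_const (μ := (μ : SignedMeasure X).variation) c).indicator hK
  rw [VectorMeasure.integral_fun_sub (integrable_bcf f μ) hi,
    VectorMeasure.integral_indicator_const c hK]
  rfl

variable {P : Set (PseudoMetric X ℝ)}

theorem apply_eq_zero_of_forall_krNorm_eq_zero (hP : GeneratesTopology P) (hd : IsDirectedFamily P)
    {μ : radonMeasures X} (hμ : ∀ p ∈ P, krNorm p μ = 0) {K : Set X} (hK : IsCompact K)
    (hKc : IsClosed K) : (μ : SignedMeasure X) K = 0 := by
  have := hP.regularSpace hd
  refine eq_of_abs_sub_le_all fun ε hε => ?_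
  obtain ⟨L, hLK, -, hLc, hLε⟩ :=
    exists_isCompact_isClosed_variation_lt μ hKc.measurableSet.compl hε
  obtain ⟨p, hp, r, hr, hrL⟩ :=
    hP.exists_thickening_subset hd hK hLc.isOpen_compl (subset_compl_comm.1 hLK)
  set s := min r 1
  have hs : 0 < s := lt_min hr one_pos
  obtain ⟨f, hf, hfs⟩ := exists_mem_lipUnitBall_coe_eq_tent (hP.subset_continuousPseudometrics hp)
    hs.le (min_le_right r 1) K
  have hμf : integralCLM μ f = 0 := abs_nonpos_iff.1 ((le_krNorm hf μ).trans_eq (hμ p hp))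
  have hbound := abs_integral_le_mul_variation (μ : SignedMeasure X) (A := Kᶜ \ L)
    (f := fun x => f x - K.indicator (fun _ => s) x) hs.le ?_ ?_
  · rw [integral_sub_indicator_const μ f hKc.measurableSet, hμf, zero_sub, abs_neg, abs_mul,
      abs_of_pos hs] at hbound
    simpa using (le_of_mul_le_mul_left hbound hs).trans hLε.le
  · rintro x ⟨hxK, -⟩
    simpa [notMem_of_mem_compl hxK, hfs] using abs_tent_le hs.le x
  · intro x hx
    by_cases hxK : x ∈ K
    · simp [hxK, hfs, tent_eq_of_mem hs.le]
    · have hxL : x ∈ L := by simpa [hxK] using hx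
      have hxs : x ∉ thickening p s K := fun ⟨y, hy, hxy⟩ =>
        hrL ⟨y, hy, hxy.trans_le (min_le_left r 1)⟩ hxL
      simpa [hxK, hfs] using Function.notMem_support.1 fun h => hxs (support_tent_subset h)

theorem t2Space_krTopology (hP : GeneratesTopology P) (hd : IsDirectedFamily P) :
    @T2Space _ (krTopology P) :=
  have := hP.regularSpace hd
  t2Space_seminormTopology fun _ h => eq_zero_of_forall_isCompact_isClosed fun _ =>
    apply_eq_zero_of_forall_krNorm_eq_zero hP hd fun _ hp => h _ (mem_image_of_mem _ hp)

end Separation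

section Subseries

theorem exists_eventually_forall_abs_le {Y : Type*} [TopologicalSpace Y] [BaireSpace Y] [Nonempty Y]
    {Φ : ℕ → Y → ℝ} (hΦ : ∀ k, Continuous (Φ k)) (hlim : ∀ y, Tendsto (fun k => Φ k y) atTop (𝓝 0))
    {ε : ℝ} (hε : 0 < ε) : ∃ y n, ∀ᶠ z in 𝓝 y, ∀ k ≥ n, |Φ k z| ≤ ε := by
  let C (n : ℕ) : Set Y := ⋂ k ≥ n, {y | |Φ k y| ≤ ε}
  have hC (n : ℕ) : IsClosed (C n) :=
    isClosed_biInter fun k _ => isClosed_le (hΦ k).abs continuous_const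
  have hUnion : ⋃ n, C n = univ := by
    refine eq_univ_of_forall fun y => mem_iUnion.2 ?_
    obtain ⟨n, hn⟩ := eventually_atTop.1 ((hlim y).abs.eventually_le_const (abs_zero.trans_lt hε))
    exact ⟨n, mem_iInter₂.2 hn⟩
  obtain ⟨n, y, hy⟩ := nonempty_interior_of_iUnion_of_closed hC hUnion
  refine ⟨y, n, ?_⟩
  filter_upwards [mem_interior_iff_mem_nhds.1 hy] with z hz
  exact fun k hk => mem_iInter₂.1 hz k hk

variable {X : Type*} [TopologicalSpace X] {h : ℕ → X →ᵇ ℝ} {g : (ℕ → Bool) → X →ᵇ ℝ}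

/-- All subseries of `∑ h j` converge pointwise to uniformly bounded continuous functions; `g A` is
the sum over the indices `j` with `A j = true`. Indexing by `ℕ → Bool` rather than `Set ℕ` provides
the product topology. -/
def HasSubseries (h : ℕ → X →ᵇ ℝ) (g : (ℕ → Bool) → X →ᵇ ℝ) : Prop :=
  (∃ C, ∀ A x, |g A x| ≤ C) ∧ ∀ A x, HasSum (fun j => if A j then h j x else 0) (g A x)

namespace HasSubseries

theorem continuous_eval (hg : HasSubseries h g) (x : X) : Continuous fun A => g A x := by
  have hsum : Summable fun j => |h j x| := by
    simpa using (hg.2 (fun _ => true) x).summable.abs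
  simp only [← fun A => (hg.2 A x).tsum_eq]
  refine continuous_tsum (fun j => ?_) hsum fun j A => ?_
  · exact (continuous_of_discreteTopology (f := fun b : Bool => if b then h j x else 0)).comp
      (continuous_apply j)
  · split_ifs <;> simp

theorem sub_update (hg : HasSubseries h g) (A : ℕ → Bool) (j : ℕ) :
    g (Function.update A j true) - g (Function.update A j false) = h j := by
  ext x
  have hsub := (hg.2 (Function.update A j true) x).sub (hg.2 (Function.update A j false) x)
  refine hsub.unique ?_
  refine (hasSum_ite_eq j (h j x)).congr_fun fun i => ?_
  obtain rfl | hij := eq_or_ne i j <;> simp [*]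

theorem eq_sum (hg : HasSubseries h g) (A : ℕ → Bool) (s : Finset ℕ) :
    g (fun j => A j && decide (j ∈ s)) = ∑ j ∈ s, if A j then h j else 0 := by
  ext x
  refine (hg.2 _ x).unique ?_
  rw [BoundedContinuousFunction.sum_apply]
  convert hasSum_sum_of_ne_finset_zero (L := .unconditional ℕ) (s := s) (f := fun j =>
    if A j && decide (j ∈ s) then h j x else 0) (fun j hj => by simp [hj]) using 1
  exact Finset.sum_congr rfl fun j hj => by cases A j <;> simp [hj]

variable [MeasurableSpace X] [OpensMeasurableSpace X]

theorem continuous_integralCLM (hg : HasSubseries h g) (μ : radonMeasures X) :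
    Continuous fun A => integralCLM μ (g A) := by
  obtain ⟨C, hC⟩ := hg.1
  exact VectorMeasure.continuous_of_dominated (bound := fun _ => C)
    (fun A => (g A).continuous.aestronglyMeasurable) (fun A => .of_forall (hC A))
    (integrable_const C) (.of_forall hg.continuous_eval)

theorem hasSum_integralCLM (hg : HasSubseries h g) (μ : radonMeasures X) (A : ℕ → Bool) :
    HasSum (fun j => if A j then integralCLM μ (h j) else 0) (integralCLM μ (g A)) := by
  have hA : Tendsto (fun (s : Finset ℕ) j => A j && decide (j ∈ s)) atTop (𝓝 A) := by
    refine tendsto_pi_nhds.2 fun j => tendsto_const_nhds.congr' ?_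
    filter_upwards [eventually_ge_atTop {j}] with s hs
    simp [Finset.singleton_subset_iff.1 hs]
  refine (((hg.continuous_integralCLM μ).tendsto A).comp hA).congr fun s => ?_
  simp only [Function.comp_apply, hg.eq_sum, map_sum]
  exact Finset.sum_congr rfl fun j _ => by split_ifs <;> simp

variable {S : Set (radonMeasures X)} {ν : ℕ → radonMeasures X}

theorem exists_tendsto_integralCLM (hg : HasSubseries h g) (hS : @IsCompact _ (weakTopology X) S)
    (hν : ∀ k, ν k ∈ S) {a : ℕ → ℝ}
    (ha : ∀ j, Tendsto (fun k => integralCLM (ν k) (h j)) atTop (𝓝 (a j))) :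
    ∃ μ, ∀ A, Tendsto (fun k => integralCLM (ν k) (g A)) atTop (𝓝 (integralCLM μ (g A))) := by
  have hlim (F : Ultrafilter ℕ) (hF : ↑F ≤ (atTop : Filter ℕ)) :
      ∃ μ, (∀ j, integralCLM μ (h j) = a j) ∧
        ∀ f, Tendsto (fun k => integralCLM (ν k) f) F (𝓝 (integralCLM μ f)) := by
    let := weakTopology X
    obtain ⟨μ, -, hμ⟩ := hS.ultrafilter_le_nhds' (F.map ν) (Ultrafilter.mem_map.2 (univ_mem' hν))
    have hμ := tendsto_weakTopology_iff.1 hμ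
    exact ⟨μ, fun j => tendsto_nhds_unique (hμ (h j)) ((ha j).mono_left hF), hμ⟩
  obtain ⟨μ, hμ, -⟩ := hlim (hyperfilter ℕ) (Nat.hyperfilter_le_atTop)
  refine ⟨μ, fun A => (tendsto_iff_ultrafilter _ _ _).2 fun F hF => ?_⟩
  obtain ⟨ρ, hρ, hlimρ⟩ := hlim F hF
  have hsum := hg.hasSum_integralCLM ρ A
  simp only [hρ, ← hμ] at hsum
  exact (hg.hasSum_integralCLM μ A).unique hsum ▸ hlimρ (g A)

/-- The Baire argument behind the lemmas of Phillips and Schur. -/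
theorem tendsto_integralCLM_zero (hg : HasSubseries h g)
    (hν : ∀ A, Tendsto (fun k => integralCLM (ν k) (g A)) atTop (𝓝 0)) {φ : ℕ → ℕ}
    (hφ : Tendsto φ atTop atTop) : Tendsto (fun k => integralCLM (ν k) (h (φ k))) atTop (𝓝 0) := by
  refine Metric.tendsto_nhds.2 fun ε hε => ?_
  obtain ⟨A, n, hA⟩ := exists_eventually_forall_abs_le
    (fun k => hg.continuous_integralCLM (ν k)) hν (by positivity : 0 < ε / 3)
  have hupd (b : Bool) : Tendsto (fun k => Function.update A (φ k) b) atTop (𝓝 A) := by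
    refine tendsto_pi_nhds.2 fun j => tendsto_const_nhds.congr' ?_
    filter_upwards [hφ.eventually_gt_atTop j] with k hk
    rw [Function.update_of_ne hk.ne]
  filter_upwards [(hupd true).eventually hA, (hupd false).eventually hA, eventually_ge_atTop n]
    with k htrue hfalse hk
  rw [Real.dist_0_eq_abs, ← hg.sub_update A (φ k), map_sub]
  grind

theorem tendsto_integralCLM_of_isCompact (hg : HasSubseries h g)
    (hS : @IsCompact _ (weakTopology X) S) (hν : ∀ k, ν k ∈ S) :
    Tendsto (fun k => integralCLM (ν k) (h k)) atTop (𝓝 0) := by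
  refine tendsto_of_subseq_tendsto fun ns hns => ?_
  let ev (μ : radonMeasures X) (j : ℕ) : ℝ := integralCLM μ (h j)
  have hev : IsCompact (ev '' S) := by
    let := weakTopology X
    exact hS.image (continuous_pi fun j => continuous_integralCLM_apply (h j))
  obtain ⟨a, -, ms, hms, ha⟩ := hev.tendsto_subseq fun k => mem_image_of_mem ev (hν (ns k))
  obtain ⟨μ, hμ⟩ := hg.exists_tendsto_integralCLM hS (fun k => hν (ns (ms k)))
    (tendsto_pi_nhds.1 ha)
  have hφ : Tendsto (fun k => ns (ms k)) atTop atTop := hns.comp hms.tendsto_atTop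
  have hμ₀ : Tendsto (fun j => integralCLM μ (h j)) atTop (𝓝 0) := by
    simpa using (hg.hasSum_integralCLM μ fun _ => true).summable.tendsto_atTop_zero
  have hdiff := hg.tendsto_integralCLM_zero (ν := fun k => ν (ns (ms k)) - μ) (fun A => by
    simpa [integralCLM_sub_apply] using (hμ A).sub_const (integralCLM μ (g A))) hφ
  refine ⟨ms, ?_⟩
  simpa [integralCLM_sub_apply] using hdiff.add (hμ₀.comp hφ)

end HasSubseries

theorem exists_forall_hasSum_of_pairwise_disjoint_support {p : PseudoMetric X ℝ}
    (hp : p ∈ continuousPseudometrics X) (hh : ∀ n, h n ∈ lipUnitBall p)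
    (hd : Pairwise fun m n => Disjoint (Function.support (h m)) (Function.support (h n))) :
    ∃ f : X →ᵇ ℝ, (∀ x, |f x| ≤ 1) ∧ ∀ x, HasSum (fun n => h n x) (f x) := by
  have hsingle (x : X) : ∃ n, ∀ j ≠ n, h j x = 0 := by
    by_cases! hx : ∃ n, h n x ≠ 0
    · obtain ⟨n, hn⟩ := hx
      exact ⟨n, fun j hj => by_contra fun hjx => disjoint_left.1 (hd hj) hjx hn⟩
    · exact ⟨0, fun j _ => hx j⟩
  choose n hn using hsingle
  have hLip (x y : X) : |h (n x) x - h (n y) y| ≤ 2 * p x y := by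
    obtain heq | hne := eq_or_ne (n x) (n y)
    · grind [(hh (n y)).2 x y]
    · grind [(hh (n x)).2 x y, (hh (n y)).2 x y, hn x _ hne.symm, hn y _ hne]
  exact ⟨.ofNormedAddCommGroup _ (continuous_of_abs_sub_le hp hLip) 1 fun x => (hh (n x)).1 x,
    fun x => (hh (n x)).1 x, fun x => hasSum_single _ (hn x)⟩

theorem exists_hasSubseries {p : PseudoMetric X ℝ} (hp : p ∈ continuousPseudometrics X)
    (hh : ∀ n, h n ∈ lipUnitBall p)
    (hd : Pairwise fun m n => Disjoint (Function.support (h m)) (Function.support (h n))) :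
    ∃ g, HasSubseries h g := by
  have hsum (A : ℕ → Bool) : ∃ f : X →ᵇ ℝ, (∀ x, |f x| ≤ 1) ∧
      ∀ x, HasSum (fun n => if A n then h n x else 0) (f x) := by
    have hle (n : ℕ) : Function.support (if A n then h n else 0 : X →ᵇ ℝ) ⊆
        Function.support (h n) := by
      split_ifs <;> simp
    obtain ⟨f, hf, hs⟩ := exists_forall_hasSum_of_pairwise_disjoint_support
      (h := fun n => if A n then h n else 0) hp
      (fun n => by split_ifs; exacts [hh n, zero_mem_lipUnitBall p])
      fun m n hmn => (hd hmn).mono (hle m) (hle n)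
    exact ⟨f, hf, fun x => by simpa only [apply_ite (fun f : X →ᵇ ℝ => f x),
      BoundedContinuousFunction.coe_zero, Pi.zero_apply] using hs x⟩
  choose g hg hs using hsum
  exact ⟨g, ⟨1, hg⟩, hs⟩

end Subseries

section Truncation

/-- The truncation of `t` to `[-b, b]`. -/
def clip (b t : ℝ) : ℝ := max (-b) (min b t)

/-- The shrinkage of `t` towards `0` by `δ`, which vanishes on `[-δ, δ]`. -/
def softThreshold (δ t : ℝ) : ℝ := t - clip δ t

variable {b t : ℝ}

theorem abs_clip_le (hb : 0 ≤ b) : |clip b t| ≤ b := by grind [clip]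

theorem abs_clip_sub_le_abs (hb : 0 ≤ b) : |clip b t - t| ≤ |t| := by grind [clip]

theorem clip_eq_self (ht : |t| ≤ b) : clip b t = t := by grind [clip]

theorem clip_zero_left : clip 0 t = 0 := by grind [clip]

theorem clip_zero_right (hb : 0 ≤ b) : clip b 0 = 0 := by grind [clip]

theorem abs_clip_sub_clip_le {a b' t' : ℝ} (hb : |b - b'| ≤ a) (ht : |t - t'| ≤ a) :
    |clip b t - clip b' t'| ≤ a := by grind [clip]

variable {δ : ℝ}

theorem abs_softThreshold_sub_le (hδ : 0 ≤ δ) : |softThreshold δ t - t| ≤ δ := by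
  grind [softThreshold, clip]

theorem abs_softThreshold_le_abs (hδ : 0 ≤ δ) : |softThreshold δ t| ≤ |t| := by
  grind [softThreshold, clip]

theorem abs_softThreshold_sub_softThreshold_le {t' : ℝ} (hδ : 0 ≤ δ) :
    |softThreshold δ t - softThreshold δ t'| ≤ |t - t'| := by
  grind [softThreshold, clip]

theorem softThreshold_eq_zero (ht : |t| ≤ δ) : softThreshold δ t = 0 := by
  grind [softThreshold, clip]

end Truncation

section Humps

variable {X : Type*} [TopologicalSpace X] {p : PseudoMetric X ℝ}

theorem exists_mem_lipUnitBall_coe_eq_softThreshold (hp : p ∈ continuousPseudometrics X) {δ : ℝ}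
    (hδ : 0 ≤ δ) {u : X →ᵇ ℝ} (hu : u ∈ lipUnitBall p) :
    ∃ v ∈ lipUnitBall p, ⇑v = fun x => softThreshold δ (u x) :=
  exists_mem_lipUnitBall_coe_eq hp (fun x => (abs_softThreshold_le_abs hδ).trans (hu.1 x))
    fun x y => (abs_softThreshold_sub_softThreshold_le hδ).trans (hu.2 x y)

theorem exists_mem_lipUnitBall_coe_eq_clip_tent (hp : p ∈ continuousPseudometrics X) {r : ℝ}
    (hr : 0 ≤ r) (hr₁ : r ≤ 1) (K : Set X) {v : X →ᵇ ℝ} (hv : v ∈ lipUnitBall p) :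
    ∃ h ∈ lipUnitBall p, ⇑h = fun x => clip (tent p r K x) (r * v x) := by
  refine exists_mem_lipUnitBall_coe_eq hp
    (fun x => (abs_clip_le (tent_nonneg x)).trans ((tent_le hr x).trans hr₁))
    fun x y => abs_clip_sub_clip_le (abs_tent_sub_le hr x y) ?_
  rw [← mul_sub, abs_mul, abs_of_nonneg hr]
  exact (mul_le_of_le_one_left (abs_nonneg _) hr₁).trans (hv.2 x y)

variable [MeasurableSpace X] [OpensMeasurableSpace X]

theorem exists_hump (hp : p ∈ continuousPseudometrics X) {r M : ℝ} (hr : 0 < r) (hr₁ : r ≤ 1)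
    {μ : radonMeasures X} (hM : ‖integralCLM μ‖ ≤ M) {u : X →ᵇ ℝ} (hu : u ∈ lipUnitBall p) :
    ∃ h ∈ lipUnitBall p, ∃ K, IsCompact K ∧ Function.support h ⊆ thickening p r K ∧
      (∀ x, h x ≠ 0 → 2 * r < |u x|) ∧
      r * (|integralCLM μ u| - (2 * M + 1) * r) ≤ |integralCLM μ h| := by
  obtain ⟨K, -, hK, hμK⟩ := exists_isCompact_variation_lt μ MeasurableSet.univ hr
  obtain ⟨v, hv, hv_eq⟩ := exists_mem_lipUnitBall_coe_eq_softThreshold hp (by positivity) hu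
    (δ := 2 * r)
  obtain ⟨h, hh, hh_eq⟩ := exists_mem_lipUnitBall_coe_eq_clip_tent hp hr.le hr₁ K hv
  refine ⟨h, hh, K, hK, fun x hx => support_tent_subset (p := p) (r := r) fun h₀ => hx ?_,
    fun x hx => ?_, ?_⟩
  · simp only [hh_eq, h₀, clip_zero_left]
  · contrapose! hx
    simp only [hh_eq, hv_eq, softThreshold_eq_zero hx, mul_zero, clip_zero_right (tent_nonneg x)]
  have hvr (x : X) : |r * v x| ≤ r := by
    rw [abs_mul, abs_of_pos hr]
    exact mul_le_of_le_one_right hr.le (hv.1 x)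
  -- `h` and `r • v` agree on `K`, where the tent is `r`, and differ by at most `r` elsewhere.
  have hclip : |integralCLM μ (h - r • v)| ≤ r * r := by
    refine (abs_integralCLM_le_mul_variation μ hr.le (A := univ \ K) (fun x _ => ?_)
      fun x hx => ?_).trans (by gcongr)
    · simpa [hh_eq] using (abs_clip_sub_le_abs (tent_nonneg x)).trans (hvr x)
    · have hxK : x ∈ K := by simpa using hx
      simp [hh_eq, tent_eq_of_mem hr.le hxK, clip_eq_self (hvr x)]
  have hsoft : |integralCLM μ (v - u)| ≤ M * (2 * r) := by
    refine (integralCLM μ).le_of_opNorm_le_of_le hM ?_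
    refine (BoundedContinuousFunction.norm_le (by positivity)).2 fun x => ?_
    simpa [hv_eq] using abs_softThreshold_sub_le (t := u x) (δ := 2 * r) (by positivity)
  rw [map_sub, map_smul, smul_eq_mul] at hclip
  rw [map_sub] at hsoft
  have hv_le : |integralCLM μ u| - M * (2 * r) ≤ |integralCLM μ v| := by grind
  have hrv : r * |integralCLM μ v| - r * r ≤ |integralCLM μ h| := by
    rw [← abs_of_pos hr, ← abs_mul, abs_of_pos hr]
    grind
  linarith [mul_le_mul_of_nonneg_left hv_le hr.le]

variable {S : Set (radonMeasures X)} {ι : Type*} {l : Filter ι} {ν : ι → radonMeasures X}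
  {u : ι → X →ᵇ ℝ}

theorem exists_seq_disjoint_support_of_frequently (hS : @IsCompact _ (weakTopology X) S)
    (hp : p ∈ continuousPseudometrics X) (hν : ∀ i, ν i ∈ S) (hu : ∀ i, u i ∈ lipUnitBall p)
    (hlim : ∀ x, Tendsto (fun i => u i x) l (𝓝 0)) {ε : ℝ} (hε : 0 < ε)
    (hfreq : ∃ᶠ i in l, ε ≤ |integralCLM (ν i) (u i)|) :
    ∃ μ : ℕ → radonMeasures X, (∀ n, μ n ∈ S) ∧ ∃ h : ℕ → X →ᵇ ℝ, (∀ n, h n ∈ lipUnitBall p) ∧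
      (Pairwise fun m n => Disjoint (Function.support (h m)) (Function.support (h n))) ∧
      ∃ c > 0, ∀ n, c ≤ |integralCLM (μ n) (h n)| := by
  obtain ⟨M, hM⟩ := exists_forall_norm_integralCLM_le hS
  obtain ⟨r, hr, hr₁, hrε⟩ : ∃ r > 0, r ≤ 1 ∧ (2 * M + 1) * r < ε := by
    have hcont : ContinuousAt (fun r => (2 * M + 1) * r) 0 := by fun_prop
    have hsmall : ∀ᶠ r in 𝓝[>] (0 : ℝ), (2 * M + 1) * r < ε :=
      nhdsWithin_le_nhds (hcont.eventually_lt_const (by simpa using hε))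
    obtain ⟨r, h, hr, hr₁⟩ := (hsmall.and (Ioc_mem_nhdsGT zero_lt_one)).exists
    exact ⟨r, hr, hr₁, h⟩
  let c := r * (ε - (2 * M + 1) * r)
  have hc : 0 < c := mul_pos hr (sub_pos.2 hrε)
  let IsHump (z : radonMeasures X × (X →ᵇ ℝ)) : Prop :=
    z.1 ∈ S ∧ z.2 ∈ lipUnitBall p ∧ c ≤ |integralCLM z.1 z.2| ∧
      ∃ K, IsCompact K ∧ Function.support z.2 ⊆ thickening p r K
  let IsDisjoint (z w : radonMeasures X × (X →ᵇ ℝ)) : Prop :=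
    Disjoint (Function.support z.2) (Function.support w.2)
  have : Std.Symm IsDisjoint := ⟨fun _ _ h => Disjoint.symm h⟩
  obtain ⟨z, hz, hdisj⟩ := exists_seq_of_forall_finset_exists' IsHump IsDisjoint fun s hs => by
    have hsmall : ∀ᶠ i in l, ∀ z ∈ s, ∀ x, z.2 x ≠ 0 → |u i x| < 2 * r := by
      refine (eventually_all_finset s).2 fun z hz => ?_
      obtain ⟨-, -, -, K, hK, hsupp⟩ := hs z hz
      filter_upwards [eventually_forall_thickening_abs_lt hp (fun i => (hu i).2) hlim hK hr]
        with i hi x hx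
      exact hi x (hsupp hx)
    obtain ⟨i, hεi, hi⟩ := (hfreq.and_eventually hsmall).exists
    obtain ⟨h, hh, K, hK, hsupp, hlarge, hge⟩ := exists_hump hp hr hr₁ (hM _ (hν i)) (hu i)
    refine ⟨(ν i, h), ⟨hν i, hh, le_trans ?_ hge, K, hK, hsupp⟩, fun z hz => ?_⟩
    · exact mul_le_mul_of_nonneg_left (sub_le_sub_right hεi _) hr.le
    · exact disjoint_left.2 fun x hzx hhx => (hi z hz x hzx).not_gt (hlarge x hhx)
  exact ⟨_, fun n => (hz n).1, _, fun n => (hz n).2.1, hdisj, c, hc, fun n => (hz n).2.2.1⟩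

theorem tendsto_integralCLM_of_tendsto_zero (hS : @IsCompact _ (weakTopology X) S)
    (hp : p ∈ continuousPseudometrics X) (hν : ∀ i, ν i ∈ S) (hu : ∀ i, u i ∈ lipUnitBall p)
    (hlim : ∀ x, Tendsto (fun i => u i x) l (𝓝 0)) :
    Tendsto (fun i => integralCLM (ν i) (u i)) l (𝓝 0) := by
  by_contra hnot
  simp only [Metric.tendsto_nhds, Real.dist_0_eq_abs] at hnot
  push Not at hnot
  obtain ⟨ε, hε, hfreq⟩ := hnot
  obtain ⟨μ, hμ, h, hh, hd, c, hc, hle⟩ :=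
    exists_seq_disjoint_support_of_frequently hS hp hν hu hlim hε hfreq
  obtain ⟨g, hg⟩ := exists_hasSubseries hp hh hd
  have hzero := (hg.tendsto_integralCLM_of_isCompact hS hμ).abs
  rw [abs_zero] at hzero
  exact hc.not_ge (ge_of_tendsto' hzero hle)

end Humps

section Coincidence

variable {X : Type*} [TopologicalSpace X] [MeasurableSpace X] [OpensMeasurableSpace X]
  {p : PseudoMetric X ℝ} {S : Set (radonMeasures X)}

theorem exists_krNorm_lt_integralCLM_add (p : PseudoMetric X ℝ) (μ : radonMeasures X) {ε : ℝ}
    (hε : 0 < ε) : ∃ f ∈ lipUnitBall p, krNorm p μ < integralCLM μ f + ε := by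
  by_contra! h
  exact (sub_lt_self _ hε).not_ge (krNorm_le fun f hf => le_sub_iff_add_le.2 (h f hf))

theorem tendsto_integralCLM_sub_of_ultrafilter (hS : @IsCompact _ (weakTopology X) S)
    (hp : p ∈ continuousPseudometrics X) {ι : Type*} {F : Ultrafilter ι} {ν : ι → radonMeasures X}
    (hν : ∀ i, ν i ∈ S) {μ : radonMeasures X} (hμ : μ ∈ S)
    (hlim : Tendsto ν F (@nhds _ (weakTopology X) μ)) {f : ι → X →ᵇ ℝ}
    (hf : ∀ i, f i ∈ lipUnitBall p) :
    Tendsto (fun i => integralCLM (ν i - μ) (f i)) F (𝓝 0) := by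
  obtain ⟨g, hg, hfg⟩ := exists_tendsto_of_lipUnitBall hp F hf
  let u (i : ι) : X →ᵇ ℝ := (2⁻¹ : ℝ) • (f i - g)
  have hu (i : ι) : u i ∈ lipUnitBall p := half_sub_mem_lipUnitBall (hf i) hg
  have hu₀ (x : X) : Tendsto (fun i => u i x) F (𝓝 0) := by
    simpa [u] using ((hfg x).sub_const (g x)).const_mul 2⁻¹
  have hνu := tendsto_integralCLM_of_tendsto_zero hS hp hν hu hu₀
  have hμu := tendsto_integralCLM_of_tendsto_zero hS hp (fun _ => hμ) hu hu₀
  have hνg : Tendsto (fun i => integralCLM (ν i) g - integralCLM μ g) F (𝓝 0) := by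
    simpa using (tendsto_weakTopology_iff.1 hlim g).sub_const (integralCLM μ g)
  have hdecomp : Tendsto (fun i => (integralCLM (ν i) g - integralCLM μ g) +
      2 * (integralCLM (ν i) (u i) - integralCLM μ (u i))) F (𝓝 0) := by
    simpa using hνg.add ((hνu.sub hμu).const_mul 2)
  refine hdecomp.congr fun i => ?_
  simp only [u, map_smul, map_sub, smul_eq_mul, integralCLM_sub_apply]
  ring

theorem tendsto_krNorm_sub (hS : @IsCompact _ (weakTopology X) S)
    (hp : p ∈ continuousPseudometrics X) {μ : radonMeasures X} (hμ : μ ∈ S) :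
    Tendsto (fun ν => krNorm p (ν - μ)) (@nhdsWithin _ (weakTopology X) μ S) (𝓝 0) := by
  let := weakTopology X
  refine (tendsto_nhdsWithin_iff_subtype hμ _ _).2 ?_
  refine (tendsto_iff_ultrafilter _ _ _).2 fun F hF =>
    tendsto_order.2 ⟨fun a ha => ?_, fun ε hε => ?_⟩
  · exact .of_forall fun ν => ha.trans_le (apply_nonneg (krSeminorm p) _)
  choose f hf hlt using fun ν : S =>
    exists_krNorm_lt_integralCLM_add p ((ν : radonMeasures X) - μ) (half_pos hε)
  have hlim := tendsto_integralCLM_sub_of_ultrafilter hS hp (fun ν : S => ν.2) hμ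
    ((continuous_subtype_val.tendsto _).mono_left hF) hf
  filter_upwards [hlim.eventually_lt_const (half_pos hε)] with ν hν
  exact (hlt ν).trans (by linarith)

theorem coincideOn_weakTopology_krTopology [BorelSpace X] (hS : @IsCompact _ (weakTopology X) S)
    {P : Set (PseudoMetric X ℝ)} (hP : GeneratesTopology P) (hd : IsDirectedFamily P) :
    CoincideOn (weakTopology X) (krTopology P) S := by
  refine coincideOn_of_continuousOn_id hS (t2Space_krTopology hP hd) fun μ hμ => ?_
  refine tendsto_seminormTopology_iff.2 (forall_mem_image.2 fun p hp => ?_)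
  exact tendsto_krNorm_sub hS (hP.subset_continuousPseudometrics hp) hμ

end Coincidence

end

end KantorovichRubinstein

theorem proposition2p3_general {X : Type*} [TopologicalSpace X] [CompletelyRegularSpace X]
    [MeasurableSpace X] [BorelSpace X] (S : Set (KantorovichRubinstein.radonMeasures X))
    (hS : @IsCompact _ (KantorovichRubinstein.weakTopology X) S) :
    KantorovichRubinstein.CoincideOn (KantorovichRubinstein.weakTopology X)
      (KantorovichRubinstein.krTopology (KantorovichRubinstein.continuousPseudometrics X)) S ∧
    ∀ P : Set (PseudoMetric X ℝ), KantorovichRubinstein.GeneratesTopology P →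
      KantorovichRubinstein.IsDirectedFamily P →
      KantorovichRubinstein.CoincideOn (KantorovichRubinstein.weakTopology X)
        (KantorovichRubinstein.krTopology P) S :=
  have h (P : Set (PseudoMetric X ℝ)) (hP : KantorovichRubinstein.GeneratesTopology P)
      (hd : KantorovichRubinstein.IsDirectedFamily P) :=
    KantorovichRubinstein.coincideOn_weakTopology_krTopology hS hP hd
  ⟨h _ (KantorovichRubinstein.generatesTopology_continuousPseudometrics X)
    (KantorovichRubinstein.isDirectedFamily_continuousPseudometrics X), h⟩

theorem proposition2p3 {X : Type*} [TopologicalSpace X] [T35Space X] [MeasurableSpace X]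
    [BorelSpace X]
    (hX : TopologicalSpace.SeparableSpace X ∨
      ∃ F : Set C(X, ℝ), F.Countable ∧ ∀ x y : X, x ≠ y → ∃ f ∈ F, f x ≠ f y)
    (S : Set (KantorovichRubinstein.radonMeasures X))
    (hS : @IsCompact _ (KantorovichRubinstein.weakTopology X) S) :
    KantorovichRubinstein.CoincideOn (KantorovichRubinstein.weakTopology X)
      (KantorovichRubinstein.krTopology (KantorovichRubinstein.continuousPseudometrics X)) S ∧
    ∀ P : Set (PseudoMetric X ℝ), KantorovichRubinstein.GeneratesTopology P →
      KantorovichRubinstein.IsDirectedFamily P →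
      KantorovichRubinstein.CoincideOn (KantorovichRubinstein.weakTopology X)
        (KantorovichRubinstein.krTopology P) S :=
  proposition2p3_general S hS
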